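/- **Theorem 3.6.** Every ultrafilter base for the computable sets uniformly computes a dominating function; that is, $\mathrm{DomFcn} \leq_s \mathcal{U}$: there is a single Turing functional $\Theta$ such that for every $F \in \mathcal{U}$ the function $\Theta^F$ is total and belongs to $\mathrm{DomFcn}$. Here: - $\mathcal{U}$ is the class of ultrafilter bases for the computable sets. For $F \subseteq \omega$ let $F_n = \{u : \langle u, n\rangle \in F\}$, where $\langle x, n \rangle = \frac{(x+n)(x+n+1)}{2} + n$ is the Cantor pairing function, and write $A \subseteq^* B$ if $A \setminus B$ is finite. Then $F \in \mathcal{U}$ if and only if every $F_n$ is computable, $F_0 = \omega$, for every $n$ one has $F_{n+1} \subseteq^* F_n$ and $F_n \setminus F_{n+1}$ is infinite, and for every computable set $R \subseteq \omega$ there is $n$ with $F_n \subseteq^* R$ or $F_n \subseteq^* \omega \setminus R$. As an oracle, $F$ is identified with its characteristic function. - $\mathrm{DomFcn}$ is the class of functions $h : \omega \to \omega$ such that $h(s) \geq s$ for all $s$ and, for every computable $f : \omega \to \omega$, $f(s) \leq h(s)$ for all but finitely many $s$. - For classes $\mathcal{C}, \mathcal{D}$ of functions $\omega \to \omega$, $\mathcal{C}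 \leq_s \mathcal{D}$ (Medvedev reducibility) means that there is a Turing functional $\Theta$ such that $\Theta^g$ is total and $\Theta^g \in \mathcal{C}$ for each $g \in \mathcal{D}$. -/

import Mathlib

namespace MassProblem

/-- Turing functionals `Θ : g ↦ Θ^g`, taking a total oracle `g : ℕ → ℕ` to a partial function
`ℕ →. ℕ`. They are the operators obtained from the initial functions and the oracle call by
pairing, composition, primitive recursion and unbounded search; the derivation does not depend on
the oracle. For a fixed oracle this is Mathlib's `Nat.RecursiveIn {g}`, and without the clause
`oracle` it is Mathlib's `Nat.Partrec`. -/
inductive IsTuringFunctional : ((ℕ → ℕ) → ℕ →. ℕ) → Prop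
  | zero : IsTuringFunctional fun _ _ => Part.some 0
  | succ : IsTuringFunctional fun _ n => Part.some (n + 1)
  | left : IsTuringFunctional fun _ n => Part.some (Nat.unpair n).1
  | right : IsTuringFunctional fun _ n => Part.some (Nat.unpair n).2
  | oracle : IsTuringFunctional fun g n => Part.some (g n)
  | pair {Φ Ψ : (ℕ → ℕ) → ℕ →. ℕ} (hΦ : IsTuringFunctional Φ) (hΨ : IsTuringFunctional Ψ) :
      IsTuringFunctional fun g n => Nat.pair <$> Φ g n <*> Ψ g n
  | comp {Φ Ψ : (ℕ → ℕ) → ℕ →. ℕ} (hΦ : IsTuringFunctional Φ) (hΨ : IsTuringFunctional Ψ) :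
      IsTuringFunctional fun g n => Ψ g n >>= Φ g
  | prec {Φ Ψ : (ℕ → ℕ) → ℕ →. ℕ} (hΦ : IsTuringFunctional Φ) (hΨ : IsTuringFunctional Ψ) :
      IsTuringFunctional fun g p =>
        let (a, n) := Nat.unpair p
        n.rec (Φ g a) fun y IH => do
          let i ← IH
          Ψ g (Nat.pair a (Nat.pair y i))
  | rfind {Φ : (ℕ → ℕ) → ℕ →. ℕ} (hΦ : IsTuringFunctional Φ) :
      IsTuringFunctional fun g a =>
        Nat.rfind fun n => (fun m => m = 0) <$> Φ g (Nat.pair a n)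

/-- Medvedev reducibility `C ≤ₛ D` of mass problems: a single Turing functional `Θ` is such that,
for every `g ∈ D`, the function `Θ^g` is total and belongs to `C`. -/
def MedvedevReducible (C D : Set (ℕ → ℕ)) : Prop :=
  ∃ Θ : (ℕ → ℕ) → ℕ →. ℕ, IsTuringFunctional Θ ∧
    ∀ g ∈ D, ∃ h ∈ C, ∀ n, Θ g n = Part.some (h n)

/-- The Cantor pairing function `⟨x, n⟩`. -/
def cantorPair (x n : ℕ) : ℕ := (x + n) * (x + n + 1) / 2 + n

/-- The column `X_n = {u : ⟨u, n⟩ ∈ X}`. -/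
def column (X : Set ℕ) (n : ℕ) : Set ℕ := {u | cantorPair u n ∈ X}

/-- Computable sets of natural numbers. -/
def IsComputableSet (R : Set ℕ) : Prop := ComputablePred fun x => x ∈ R

/-- `A ⊆* B`: all but finitely many elements of `A` belong to `B`. -/
def AlmostSubset (A B : Set ℕ) : Prop := (A \ B).Finite

/-- `F` codes, through its columns, a tower of computable sets. -/
structure IsTower (F : Set ℕ) : Prop where
  computable : ∀ n, IsComputableSet (column F n)
  zero : column F 0 = Set.univ
  almost_subset : ∀ n, AlmostSubset (column F (n + 1)) (column F n)
  infinite_diff : ∀ n, (column F n \ column F (n + 1)).Infinite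

/-- `F` is an ultrafilter base for the computable sets. -/
structure IsUltrafilterBase (F : Set ℕ) : Prop extends IsTower F where
  decides : ∀ R : Set ℕ, IsComputableSet R →
    ∃ n, AlmostSubset (column F n) Rᶜ ∨ AlmostSubset (column F n) R

/-- The characteristic function of a set. -/
noncomputable def charFun (X : Set ℕ) : ℕ → ℕ := X.indicator fun _ => 1

/-- The mass problem `𝒰` of ultrafilter bases, a set being identified with its characteristic
function. -/
def UltrafilterBases : Set (ℕ → ℕ) := {g | ∃ F : Set ℕ, IsUltrafilterBase F ∧ g = charFun F}

/-- The mass problem of functions that dominate every computable function and are bounded below by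
the identity. -/
def DomFcn : Set (ℕ → ℕ) :=
  {h | (∀ f : ℕ → ℕ, Computable f → ∃ N, ∀ s ≥ N, f s ≤ h s) ∧ ∀ s, s ≤ h s}

end MassProblem

/-!
An ultrafilter base `F` makes totality of a program `e` a `Σ₂` property relative to `F`: `e` is
total if and only if some column `F_n`, from some point on, is never seen to include certain finite
sets. A dominating function then waits, for each `e` and `n`, for a value of `e` or for such a set.

The stages of `e` fall into blocks: a block lasts as long as no further initial argument converges.
So `e` is total exactly when all blocks are finite. Within each block the computably enumerable sets
`{x ∈ dom c | b ≤ x}` are enumerated. Index them by `i`; the `i`-th one has a *thick* trace in the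
block if at least `2 * i + 2` of its elements in the block show up before the block ends.

* If `e` is total, some computable set `R` splits every thick trace
  (`exists_isComputableSet_splitting`): each finite block has finitely many of them, they can be
  split greedily, and the end of a block can be found effectively. Some column `F_n` is almost
  contained in `R` or in its complement, so above some bound it includes no thick trace.
* If `e` diverges somewhere, the last block is infinite. Each column `F_n` is infinite and
  computable, so above any bound it is itself one of the enumerated sets, and it includes a thick
  trace of its own index (`IsTower.eventually_settled`). Here it matters that the columns themselves
  are computable.

Let `h s` be the least `t ≥ s` such that for every pair of a program `e` and a column `n` with code
below `s`, either `e` has halted at `s` with a value below `t`, or `F_n` above `s` has been seen to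
include a thick trace. The second item makes `h` total, and the first one makes it dominate every
computable function (`IsUltrafilterBase.eventually_le`). The search is carried out by a single
functional (`IsTuringFunctional.exists_search`), since all conditions are primitive recursive in
the finitely many oracle values known at stage `t`.
-/

open Encodable Denumerable Nat.Partrec

/-! ### Turing functionals given by search -/

namespace MassProblem

namespace IsTuringFunctional

theorem of_eq {Φ Ψ : (ℕ → ℕ) → ℕ →. ℕ} (hΦ : IsTuringFunctional Φ) (h : ∀ g n, Φ g n = Ψ g n) :
    IsTuringFunctional Ψ :=
  (funext₂ h : Φ = Ψ) ▸ hΦ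

theorem of_partrec {f : ℕ →. ℕ} (hf : Nat.Partrec f) : IsTuringFunctional fun _ => f := by
  induction hf with
  | zero => exact .zero
  | succ => exact .succ
  | left => exact .left
  | right => exact .right
  | pair _ _ hf hg => exact hf.pair hg
  | comp _ _ hf hg => exact hf.comp hg
  | prec _ _ hf hg => exact hf.prec hg
  | rfind _ hf => exact hf.rfind

theorem of_primrec {f : ℕ → ℕ} (hf : Primrec f) :
    IsTuringFunctional fun _ n => Part.some (f n) :=
  of_partrec (Nat.Partrec.of_primrec (Primrec.nat_iff.1 hf))

theorem comp_some {φ ψ : (ℕ → ℕ) → ℕ → ℕ}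
    (hφ : IsTuringFunctional fun g n => Part.some (φ g n))
    (hψ : IsTuringFunctional fun g n => Part.some (ψ g n)) :
    IsTuringFunctional fun g n => Part.some (φ g (ψ g n)) :=
  (hφ.comp hψ).of_eq fun g n => by simp

theorem pair_some {φ ψ : (ℕ → ℕ) → ℕ → ℕ}
    (hφ : IsTuringFunctional fun g n => Part.some (φ g n))
    (hψ : IsTuringFunctional fun g n => Part.some (ψ g n)) :
    IsTuringFunctional fun g n => Part.some (Nat.pair (φ g n) (ψ g n)) :=
  (hφ.pair hψ).of_eq fun g n => by simp [Seq.seq]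

/-- The initial segments of the oracle, as codes of lists, are computable from the oracle. -/
theorem encode_map_range :
    IsTuringFunctional fun g n => Part.some (encode ((List.range n).map g)) := by
  have hstep : IsTuringFunctional fun g p => Part.some
      (encode (ofNat (List ℕ) p.unpair.2.unpair.2 ++ [g p.unpair.2.unpair.1])) := by
    have happ : Primrec fun q : ℕ => encode (ofNat (List ℕ) q.unpair.1 ++ [q.unpair.2]) :=
      Primrec.encode.comp (Primrec.list_concat.comp
        ((Primrec.ofNat _).comp (Primrec.fst.comp Primrec.unpair))
        (Primrec.snd.comp Primrec.unpair))
    have hl : Primrec fun p : ℕ => p.unpair.2.unpair.2 :=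
      Primrec.snd.comp (Primrec.unpair.comp (Primrec.snd.comp Primrec.unpair))
    have hy : Primrec fun p : ℕ => p.unpair.2.unpair.1 :=
      Primrec.fst.comp (Primrec.unpair.comp (Primrec.snd.comp Primrec.unpair))
    refine (comp_some (of_primrec happ)
      (pair_some (of_primrec hl) (oracle.comp_some (of_primrec hy)))).of_eq fun g p => ?_
    simp
  have hrec := (of_primrec (Primrec.const (encode ([] : List ℕ)))).prec hstep
  refine (hrec.comp (pair_some zero (of_primrec Primrec.id))).of_eq fun g n => ?_
  simp only [Part.bind_eq_bind, Part.bind_some, Nat.unpair_pair, id]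
  induction n with
  | zero => rfl
  | succ n ih =>
    change Part.bind _ _ = _
    rw [ih]
    simp [List.range_succ]

/-- Unbounded search for a stage `t` at which a primitive recursive condition on the input, on `t`
and on the first `t` values of the oracle is met is a Turing functional. -/
theorem exists_search {Q : ℕ × ℕ × List ℕ → Prop} (hQ : PrimrecPred Q) :
    ∃ Θ, IsTuringFunctional Θ ∧ ∀ g, (∀ s, ∃ t, Q (s, t, (List.range t).map g)) →
      ∃ h : ℕ → ℕ, (∀ s, Θ g s = Part.some (h s)) ∧
        ∀ s, Q (s, h s, (List.range (h s)).map g) := by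
  classical
  let q : ℕ → ℕ := fun m =>
    if Q (m.unpair.1.unpair.1, m.unpair.1.unpair.2, ofNat (List ℕ) m.unpair.2) then 0 else 1
  have hq : Primrec q := by
    refine Primrec.ite (hQ.comp ?_) (Primrec.const 0) (Primrec.const 1)
    have h1 := Primrec.fst.comp Primrec.unpair
    have h2 := Primrec.unpair.comp h1
    exact (Primrec.fst.comp h2).pair ((Primrec.snd.comp h2).pair
      ((Primrec.ofNat _).comp (Primrec.snd.comp Primrec.unpair)))
  have hmain : IsTuringFunctional fun g m => Part.some
      (if Q (m.unpair.1, m.unpair.2, (List.range m.unpair.2).map g) then 0 else 1) :=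
    (comp_some (of_primrec hq) (pair_some (of_primrec Primrec.id)
      (encode_map_range.comp_some (of_primrec (Primrec.snd.comp Primrec.unpair))))).of_eq
      fun g m => by simp [q]
  refine ⟨_, hmain.rfind, fun g hg => ⟨fun s => Nat.find (hg s), fun s => ?_,
    fun s => Nat.find_spec (hg s)⟩⟩
  refine Part.eq_some_iff.2 (Nat.mem_rfind.2 ⟨?_, fun {m} hm => ?_⟩)
  · simpa using Nat.find_spec (hg s)
  · simpa using Nat.find_min (hg s) hm

end IsTuringFunctional

end MassProblem

/-! ### Primitive recursive predicates with parameters -/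

namespace PrimrecPred

variable {α β : Type*} [Primcodable α] [Primcodable β]

theorem imp {p q : α → Prop} (hp : PrimrecPred p) (hq : PrimrecPred q) :
    PrimrecPred fun a => p a → q a :=
  (hp.not.or hq).of_eq fun _ => imp_iff_not_or.symm

theorem forall_mem {f : α → List β} {p : α → β → Prop} (hf : Primrec f)
    (hp : PrimrecPred fun q : α × β => p q.1 q.2) : PrimrecPred fun a => ∀ x ∈ f a, p a x :=
  (PrimrecRel.forall_mem_list (R := fun x a => p a x)
    (hp.comp (Primrec.snd.pair Primrec.fst))).comp hf Primrec.id

theorem exists_mem {f : α → List β} {p : α → β → Prop} (hf : Primrec f)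
    (hp : PrimrecPred fun q : α × β => p q.1 q.2) : PrimrecPred fun a => ∃ x ∈ f a, p a x :=
  (PrimrecRel.exists_mem_list (R := fun x a => p a x)
    (hp.comp (Primrec.snd.pair Primrec.fst))).comp hf Primrec.id

theorem forall_lt_param {f : α → ℕ} {p : α → ℕ → Prop} (hf : Primrec f)
    (hp : PrimrecPred fun q : α × ℕ => p q.1 q.2) : PrimrecPred fun a => ∀ x < f a, p a x :=
  (forall_mem (Primrec.list_range.comp hf) hp).of_eq fun _ => by simp

theorem exists_lt_param {f : α → ℕ} {p : α → ℕ → Prop} (hf : Primrec f)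
    (hp : PrimrecPred fun q : α × ℕ => p q.1 q.2) : PrimrecPred fun a => ∃ x < f a, p a x :=
  (exists_mem (Primrec.list_range.comp hf) hp).of_eq fun _ => by simp

end PrimrecPred

namespace Primrec

variable {α β : Type*} [Primcodable α] [Primcodable β]

theorem list_filter_param {f : α → List β} {p : α → β → Prop} [∀ a x, Decidable (p a x)]
    (hf : Primrec f) (hp : PrimrecPred fun q : α × β => p q.1 q.2) :
    Primrec fun a => (f a).filter fun x => p a x :=
  (PrimrecRel.listFilter (R := fun x a => p a x)
    (hp.comp (Primrec.snd.pair Primrec.fst))).comp hf Primrec.id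

theorem mem_list {f : α → β} {l : α → List β} (hf : Primrec f) (hl : Primrec l) :
    PrimrecPred fun a => f a ∈ l a :=
  (PrimrecPred.exists_mem (p := fun a x => x = f a) hl
    (Primrec.eq.comp Primrec.snd (hf.comp Primrec.fst))).of_eq fun a => by simp

end Primrec

namespace MassProblem

/-! ### Blocks of stages and traces of enumerable sets -/

/-- The number of initial arguments on which the program `e` has halted by stage `x`. Stages with
the same value form a *block* of `e`. -/
def convLength (e : Code) (x : ℕ) : ℕ :=
  (List.range x).findIdx fun j => (Code.evaln x e j).isNone

/-- `evaln x e j` is undefined for `j ≥ x`, so the restriction to `List.range x` loses nothing. -/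
theorem lt_convLength {e : Code} {x j : ℕ} :
    j < convLength e x ↔ ∀ k ≤ j, (Code.evaln x e k).isSome := by
  constructor
  · intro hj k hk
    have hk' := List.not_of_lt_findIdx (lt_of_le_of_lt hk hj)
    simpa [Option.isSome_iff_ne_none] using hk'
  · intro h
    by_contra! hj
    have h1 := h _ hj
    obtain ⟨v, hv⟩ := Option.isSome_iff_exists.1 h1
    have hlt : convLength e x < (List.range x).length := by simpa using Code.evaln_bound hv
    have h2 : (Code.evaln x e (List.range x)[convLength e x]).isNone = true :=
      List.findIdx_getElem (w := hlt)
    simp [hv] at h2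

theorem isSome_evaln_mono {c : Code} {x y n : ℕ} (hxy : x ≤ y) (h : (Code.evaln x c n).isSome) :
    (Code.evaln y c n).isSome := by
  obtain ⟨v, hv⟩ := Option.isSome_iff_exists.1 h
  exact Option.isSome_iff_exists.2 ⟨v, Code.evaln_mono hxy hv⟩

theorem dom_eval_of_isSome_evaln {c : Code} {x n : ℕ} (h : (Code.evaln x c n).isSome) :
    (Code.eval c n).Dom := by
  obtain ⟨v, hv⟩ := Option.isSome_iff_exists.1 h
  exact Part.dom_iff_mem.2 ⟨v, Code.evaln_sound hv⟩

theorem exists_isSome_evaln {c : Code} {n : ℕ} (h : (Code.eval c n).Dom) :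
    ∃ x, (Code.evaln x c n).isSome := by
  obtain ⟨v, hv⟩ := Part.dom_iff_mem.1 h
  obtain ⟨k, hk⟩ := Code.evaln_complete.1 hv
  exact ⟨k, Option.isSome_iff_exists.2 ⟨v, hk⟩⟩

theorem convLength_mono (e : Code) : Monotone (convLength e) := by
  intro x y hxy
  refine le_of_forall_lt fun j hj => ?_
  exact lt_convLength.2 fun k hk => isSome_evaln_mono hxy (lt_convLength.1 hj k hk)

theorem exists_lt_convLength {e : Code} (he : ∀ k, (Code.eval e k).Dom) (l : ℕ) :
    ∃ x, l < convLength e x := by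
  choose t ht using fun k => exists_isSome_evaln (he k)
  refine ⟨(Finset.range (l + 1)).sup t, lt_convLength.2 fun k hk => ?_⟩
  exact isSome_evaln_mono (Finset.le_sup (by simpa [Nat.lt_succ_iff] using hk)) (ht k)

theorem exists_convLength_eq {e : Code} {s : ℕ} (hs : ¬ (Code.eval e s).Dom) :
    ∃ x₀, ∀ x ≥ x₀, convLength e x = convLength e x₀ := by
  have hb : BddAbove (Set.range (convLength e)) := by
    refine ⟨s, ?_⟩
    rintro _ ⟨x, rfl⟩
    by_contra! h
    exact hs (dom_eval_of_isSome_evaln (lt_convLength.1 h s le_rfl))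
  obtain ⟨x₀, hx₀⟩ := Nat.sSup_mem (Set.range_nonempty _) hb
  exact ⟨x₀, fun x hx => le_antisymm (hx₀ ▸ le_csSup hb ⟨x, rfl⟩) (convLength_mono e hx)⟩

/-- The part, inside the block of `e` that contains the stage `w`, of the `i`-th enumerable set as
known at stage `w`. An index `i` is a pair of a program `c` and a number `b`; it stands for the
elements of the domain of `c` that are at least `b`. -/
def trace (e : Code) (i w : ℕ) : List ℕ :=
  (List.range w).filter fun x => convLength e x = convLength e w ∧ i.unpair.2 ≤ x ∧
    (Code.evaln w (ofNat Code i.unpair.1) x).isSome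

theorem mem_trace {e : Code} {i w x : ℕ} :
    x ∈ trace e i w ↔ x < w ∧ convLength e x = convLength e w ∧ i.unpair.2 ≤ x ∧
      (Code.evaln w (ofNat Code i.unpair.1) x).isSome := by
  simp [trace]

theorem nodup_trace (e : Code) (i w : ℕ) : (trace e i w).Nodup :=
  List.nodup_range.filter _

theorem length_trace_le (e : Code) (i w : ℕ) : (trace e i w).length ≤ w :=
  (List.length_filter_le _ _).trans_eq List.length_range

theorem trace_subset {e : Code} {i w w' : ℕ} (hw : w ≤ w')
    (h : convLength e w = convLength e w') : trace e i w ⊆ trace e i w' := by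
  intro x hx
  obtain ⟨h1, h2, h3, h4⟩ := mem_trace.1 hx
  exact mem_trace.2 ⟨h1.trans_le hw, h2.trans h, h3, isSome_evaln_mono hw h4⟩

/-- A trace of index `i` is thick if it has two elements more than can be used up in splitting the
thick traces of smaller index. -/
def Thick (e : Code) (i w : ℕ) : Prop :=
  2 * i + 2 ≤ (trace e i w).length

theorem Thick.lt {e : Code} {i w : ℕ} (h : Thick e i w) : i < w := by
  have := length_trace_le e i w
  unfold Thick at h
  omega

theorem primrec_convLength : Primrec fun p : Code × ℕ => convLength p.1 p.2 := by
  refine Primrec.list_findIdx (Primrec.list_range.comp Primrec.snd) ?_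
  have h1 : Primrec fun q : (Code × ℕ) × ℕ => (Code.evaln q.1.2 q.1.1 q.2).isSome :=
    Primrec.option_isSome.comp (Code.primrec_evaln.comp
      (((Primrec.snd.comp Primrec.fst).pair (Primrec.fst.comp Primrec.fst)).pair Primrec.snd))
  exact (Primrec.not.comp h1).of_eq fun q => by simp

theorem primrec_trace : Primrec fun p : Code × ℕ × ℕ => trace p.1 p.2.1 p.2.2 := by
  have he : Primrec fun q : (Code × ℕ × ℕ) × ℕ => q.1.1 := Primrec.fst.comp Primrec.fst
  have hi : Primrec fun q : (Code × ℕ × ℕ) × ℕ => q.1.2.1.unpair :=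
    Primrec.unpair.comp (Primrec.fst.comp (Primrec.snd.comp Primrec.fst))
  have hw : Primrec fun q : (Code × ℕ × ℕ) × ℕ => q.1.2.2 :=
    Primrec.snd.comp (Primrec.snd.comp Primrec.fst)
  refine Primrec.list_filter_param (Primrec.list_range.comp (Primrec.snd.comp Primrec.snd)) ?_
  refine (Primrec.eq.comp (primrec_convLength.comp (he.pair Primrec.snd))
    (primrec_convLength.comp (he.pair hw))).and
    ((Primrec.nat_le.comp (Primrec.snd.comp hi) Primrec.snd).and ?_)
  exact Primrec.eq.comp (Primrec.option_isSome.comp (Code.primrec_evaln.comp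
    ((hw.pair ((Primrec.ofNat _).comp (Primrec.fst.comp hi))).pair Primrec.snd)))
    (Primrec.const true)

theorem primrecPred_thick : PrimrecPred fun p : Code × ℕ × ℕ => Thick p.1 p.2.1 p.2.2 :=
  Primrec.nat_le.comp (Primrec.nat_add.comp (Primrec.nat_mul.comp (Primrec.const 2)
    (Primrec.fst.comp Primrec.snd)) (Primrec.const 2)) (Primrec.list_length.comp primrec_trace)

/-! ### Splitting all thick traces of a total program -/

/-- The list `r` splits the trace of index `i` at stage `w`: it contains some, but not all, of its
elements. -/
def Splits (r : List ℕ) (e : Code) (i w : ℕ) : Prop :=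
  (∃ x ∈ trace e i w, x ∈ r) ∧ ∃ x ∈ trace e i w, x ∉ r

theorem primrecPred_splits :
    PrimrecPred fun p : List ℕ × Code × ℕ × ℕ => Splits p.1 p.2.1 p.2.2.1 p.2.2.2 := by
  have hmem : PrimrecPred fun q : (List ℕ × Code × ℕ × ℕ) × ℕ => q.2 ∈ q.1.1 :=
    Primrec.snd.mem_list (Primrec.fst.comp Primrec.fst)
  have htr : Primrec fun p : List ℕ × Code × ℕ × ℕ => trace p.2.1 p.2.2.1 p.2.2.2 :=
    primrec_trace.comp Primrec.snd
  exact (PrimrecPred.exists_mem htr hmem).and (PrimrecPred.exists_mem htr hmem.not)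

/-- Greedy splitting: finitely many sets, the `i`-th with at least `2 * i + 2` elements, are split
simultaneously. -/
theorem exists_disjoint_splitting (A : ℕ → Finset ℕ) (hA : ∀ i, 2 * i + 2 ≤ (A i).card) (m : ℕ) :
    ∃ P N : Finset ℕ, Disjoint P N ∧ P.card ≤ m ∧ N.card ≤ m ∧
      ∀ i < m, (∃ x ∈ A i, x ∈ P) ∧ ∃ x ∈ A i, x ∈ N := by
  induction m with
  | zero => exact ⟨∅, ∅, by simp⟩
  | succ m ih =>
    obtain ⟨P, N, hPN, hP, hN, h⟩ := ih
    have hcard : 1 < (A m \ (P ∪ N)).card := by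
      have h1 := Finset.le_card_sdiff (P ∪ N) (A m)
      have h2 := Finset.card_union_le P N
      have h3 := hA m
      omega
    obtain ⟨x, hx, y, hy, hxy⟩ := Finset.one_lt_card.1 hcard
    simp only [Finset.mem_sdiff, Finset.mem_union, not_or] at hx hy
    refine ⟨insert x P, insert y N, ?_, (Finset.card_insert_le _ _).trans (by omega),
      (Finset.card_insert_le _ _).trans (by omega), fun i hi => ?_⟩
    · simp only [Finset.disjoint_insert_left, Finset.disjoint_insert_right, Finset.mem_insert,
        not_or]
      exact ⟨⟨hxy.symm, hy.2.1⟩, hx.2.2, hPN⟩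
    · rcases Nat.lt_succ_iff_lt_or_eq.1 hi with hi | rfl
      · obtain ⟨⟨u, hu, hu'⟩, v, hv, hv'⟩ := h i hi
        exact ⟨⟨u, hu, Finset.mem_insert_of_mem hu'⟩, v, hv, Finset.mem_insert_of_mem hv'⟩
      · exact ⟨⟨x, hx.1, Finset.mem_insert_self _ _⟩, y, hy.1, Finset.mem_insert_self _ _⟩

/-- Within one block, traces of a fixed index increase with the stage, so it is enough to split the
first thick one. -/
theorem exists_block_splitting (e : Code) (l m : ℕ) :
    ∃ r : List ℕ, ∀ w, convLength e w = l → ∀ i < m, Thick e i w → Splits r e i w := by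
  classical
  have hA : ∀ i, ∃ A : Finset ℕ, 2 * i + 2 ≤ A.card ∧
      ∀ w, convLength e w = l → Thick e i w → ∀ x ∈ A, x ∈ trace e i w := by
    intro i
    by_cases h : ∃ w, convLength e w = l ∧ Thick e i w
    · refine ⟨(trace e i (Nat.find h)).toFinset, ?_, fun w hw hi x hx => ?_⟩
      · rw [List.toFinset_card_of_nodup (nodup_trace _ _ _)]
        exact (Nat.find_spec h).2
      · exact trace_subset (Nat.find_min' h ⟨hw, hi⟩) ((Nat.find_spec h).1.trans hw.symm)
          (List.mem_toFinset.1 hx)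
    · exact ⟨Finset.range (2 * i + 2), by simp, fun w hw hi => absurd ⟨w, hw, hi⟩ h⟩
  choose A hcard hsub using hA
  obtain ⟨P, N, hPN, -, -, h⟩ := exists_disjoint_splitting A hcard m
  refine ⟨P.toList, fun w hw i hi ht => ?_⟩
  obtain ⟨⟨x, hx, hxP⟩, y, hy, hyN⟩ := h i hi
  refine ⟨⟨x, hsub i w hw ht x hx, Finset.mem_toList.2 hxP⟩, y, hsub i w hw ht y hy, fun hyP => ?_⟩
  exact Finset.disjoint_left.1 hPN (Finset.mem_toList.1 hyP) hyN

/-- For a total program every block is finite, and its end can be found effectively; so a splitting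
of all thick traces can be chosen block by block by a computable search. -/
theorem exists_isComputableSet_splitting {e : Code} (he : ∀ k, (Code.eval e k).Dom) :
    ∃ R, IsComputableSet R ∧ ∀ i w, Thick e i w →
      (∃ x ∈ trace e i w, x ∈ R) ∧ ∃ x ∈ trace e i w, x ∉ R := by
  classical
  -- `q` codes a stage beyond block `l` together with a list that splits the traces in that block.
  let S : ℕ → ℕ → Prop := fun l q => l < convLength e q.unpair.1 ∧
    ∀ w < q.unpair.1, convLength e w = l → ∀ i < w, Thick e i w →
      Splits (ofNat (List ℕ) q.unpair.2) e i w
  have hL : Primrec (convLength e) := primrec_convLength.comp ((Primrec.const e).pair Primrec.id)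
  have hS : PrimrecPred fun p : ℕ × ℕ => S p.1 p.2 := by
    have hv : Primrec fun p : ℕ × ℕ => p.2.unpair.1 :=
      Primrec.fst.comp (Primrec.unpair.comp Primrec.snd)
    have hr : Primrec fun p : ℕ × ℕ => ofNat (List ℕ) p.2.unpair.2 :=
      (Primrec.ofNat _).comp (Primrec.snd.comp (Primrec.unpair.comp Primrec.snd))
    have harg : Primrec fun p : ((ℕ × ℕ) × ℕ) × ℕ => (e, p.2, p.1.2) :=
      (Primrec.const e).pair (Primrec.snd.pair (Primrec.snd.comp Primrec.fst))
    have hr' : Primrec fun p : ((ℕ × ℕ) × ℕ) × ℕ => ofNat (List ℕ) p.1.1.2.unpair.2 :=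
      hr.comp (Primrec.fst.comp Primrec.fst)
    have hblock : PrimrecPred fun p : (ℕ × ℕ) × ℕ => convLength e p.2 = p.1.1 :=
      Primrec.eq.comp (hL.comp Primrec.snd) (Primrec.fst.comp Primrec.fst)
    have hsplit := (primrecPred_thick.comp harg).imp (primrecPred_splits.comp (hr'.pair harg))
    exact (Primrec.nat_lt.comp Primrec.fst (hL.comp hv)).and
      (PrimrecPred.forall_lt_param hv
        (hblock.imp (PrimrecPred.forall_lt_param Primrec.snd hsplit)))
  have hex : ∀ l, ∃ q, S l q := by
    intro l
    obtain ⟨v, hv⟩ := exists_lt_convLength he l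
    obtain ⟨r, hr⟩ := exists_block_splitting e l v
    refine ⟨Nat.pair v (encode r), ?_⟩
    simp only [S, Nat.unpair_pair, ofNat_encode]
    exact ⟨hv, fun w hw hl i hi ht => hr w hl i (hi.trans hw) ht⟩
  have hfind : Computable fun l => Nat.find (hex l) := Computable.find hS.computablePred hex
  refine ⟨{x | x ∈ ofNat (List ℕ) (Nat.find (hex (convLength e x))).unpair.2}, ?_,
    fun i w ht => ?_⟩
  · have hmem : PrimrecPred fun p : ℕ × ℕ => p.1 ∈ ofNat (List ℕ) p.2.unpair.2 :=
      Primrec.fst.mem_list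
        ((Primrec.ofNat _).comp (Primrec.snd.comp (Primrec.unpair.comp Primrec.snd)))
    exact Computable.computablePred (hmem.decide.to_comp.comp
      (Computable.id.pair (hfind.comp hL.to_comp)))
  · obtain ⟨h1, h2⟩ := Nat.find_spec (hex (convLength e w))
    have hw := (convLength_mono e).reflect_lt h1
    obtain ⟨⟨x, hx, hxr⟩, y, hy, hyr⟩ := h2 w hw rfl i ht.lt ht
    refine ⟨⟨x, hx, ?_⟩, y, hy, ?_⟩
    · simpa only [Set.mem_ofPred_eq, (mem_trace.1 hx).2.1] using hxr
    · simpa only [Set.mem_ofPred_eq, (mem_trace.1 hy).2.1] using hyr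

/-! ### The search condition -/

theorem primrec₂_cantorPair : Primrec₂ cantorPair := by
  have h := Primrec.nat_add.comp Primrec.fst (Primrec.snd (α := ℕ) (β := ℕ))
  exact Primrec.nat_add.comp (Primrec.nat_div.comp
    (Primrec.nat_mul.comp h (Primrec.succ.comp h)) (Primrec.const 2)) Primrec.snd

/-- The finite part `g` of a characteristic function confirms that column `n` includes the trace of
index `i` at stage `w`. -/
def TraceInColumn (g : List ℕ) (n : ℕ) (e : Code) (i w : ℕ) : Prop :=
  ∀ x ∈ trace e i w, g[cantorPair x n]? = some 1

theorem primrecPred_traceInColumn : PrimrecPred fun p : List ℕ × ℕ × Code × ℕ × ℕ =>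
    TraceInColumn p.1 p.2.1 p.2.2.1 p.2.2.2.1 p.2.2.2.2 := by
  have hx : PrimrecPred fun q : (List ℕ × ℕ × Code × ℕ × ℕ) × ℕ =>
      q.1.1[cantorPair q.2 q.1.2.1]? = some 1 :=
    Primrec.eq.comp (Primrec.list_getElem?.comp (Primrec.fst.comp Primrec.fst)
      (primrec₂_cantorPair.comp Primrec.snd (Primrec.fst.comp (Primrec.snd.comp Primrec.fst))))
      (Primrec.const (some 1))
  have htr : Primrec fun p : List ℕ × ℕ × Code × ℕ × ℕ => trace p.2.2.1 p.2.2.2.1 p.2.2.2.2 :=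
    primrec_trace.comp (Primrec.snd.comp Primrec.snd)
  exact PrimrecPred.forall_mem htr hx

/-- At stage `t`, with `g` known below `t`, the search for a value at `s` need not wait any longer
for the pair `j` of a program `e` and a column `n`: either `e` has produced its value at `s`, or
column `n` above `s` includes a thick trace, and so does not witness that `e` is total. -/
def Settled (j s t : ℕ) (g : List ℕ) : Prop :=
  (∃ v < t, Code.evaln t (ofNat Code j.unpair.1) s = some v) ∨
    ∃ w < t, ∃ i < w, i.unpair.2 = s ∧ Thick (ofNat Code j.unpair.1) i w ∧
      TraceInColumn g j.unpair.2 (ofNat Code j.unpair.1) i w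

theorem primrecPred_settled :
    PrimrecPred fun p : (ℕ × ℕ × List ℕ) × ℕ => Settled p.2 p.1.1 p.1.2.1 p.1.2.2 := by
  have hs : Primrec fun p : (ℕ × ℕ × List ℕ) × ℕ => p.1.1 := Primrec.fst.comp Primrec.fst
  have ht : Primrec fun p : (ℕ × ℕ × List ℕ) × ℕ => p.1.2.1 :=
    Primrec.fst.comp (Primrec.snd.comp Primrec.fst)
  have hg : Primrec fun p : (ℕ × ℕ × List ℕ) × ℕ => p.1.2.2 :=
    Primrec.snd.comp (Primrec.snd.comp Primrec.fst)
  have he : Primrec fun p : (ℕ × ℕ × List ℕ) × ℕ => ofNat Code p.2.unpair.1 :=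
    (Primrec.ofNat _).comp (Primrec.fst.comp (Primrec.unpair.comp Primrec.snd))
  have hn : Primrec fun p : (ℕ × ℕ × List ℕ) × ℕ => p.2.unpair.2 :=
    Primrec.snd.comp (Primrec.unpair.comp Primrec.snd)
  have hval : PrimrecPred fun p : ((ℕ × ℕ × List ℕ) × ℕ) × ℕ =>
      Code.evaln p.1.1.2.1 (ofNat Code p.1.2.unpair.1) p.1.1.1 = some p.2 :=
    Primrec.eq.comp (Code.primrec_evaln.comp (((ht.pair he).pair hs).comp Primrec.fst))
      (Primrec.option_some.comp Primrec.snd)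
  have hbase : Primrec fun p : (((ℕ × ℕ × List ℕ) × ℕ) × ℕ) × ℕ => p.1.1 :=
    Primrec.fst.comp Primrec.fst
  have harg : Primrec fun p : (((ℕ × ℕ × List ℕ) × ℕ) × ℕ) × ℕ =>
      (ofNat Code p.1.1.2.unpair.1, p.2, p.1.2) :=
    (he.comp hbase).pair (Primrec.snd.pair (Primrec.snd.comp Primrec.fst))
  have hcut : PrimrecPred fun p : (((ℕ × ℕ × List ℕ) × ℕ) × ℕ) × ℕ =>
      p.2.unpair.2 = p.1.1.1.1 :=
    Primrec.eq.comp (Primrec.snd.comp (Primrec.unpair.comp Primrec.snd)) (hs.comp hbase)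
  have hcol := primrecPred_traceInColumn.comp
    ((hg.comp hbase).pair ((hn.comp hbase).pair harg))
  exact (PrimrecPred.exists_lt_param ht hval).or
    (PrimrecPred.exists_lt_param ht (PrimrecPred.exists_lt_param Primrec.snd
      (hcut.and ((primrecPred_thick.comp harg).and hcol))))

theorem getElem?_map_range_charFun {F : Set ℕ} {t k : ℕ} :
    ((List.range t).map (charFun F))[k]? = some 1 ↔ k < t ∧ k ∈ F := by
  classical
  simp only [List.getElem?_map, Option.map_eq_some_iff]
  by_cases hk : k < t <;> by_cases hF : k ∈ F <;> simp [charFun, hk, hF]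

/-! ### Totality and domination -/

theorem IsTower.infinite_column {F : Set ℕ} (hF : IsTower F) (n : ℕ) : (column F n).Infinite :=
  (hF.infinite_diff n).mono Set.sdiff_subset

theorem IsComputableSet.exists_code {R : Set ℕ} (hR : IsComputableSet R) :
    ∃ c : Code, ∀ x, (Code.eval c x).Dom ↔ x ∈ R := by
  have h : Partrec fun x : ℕ => (Part.assert (x ∈ R) fun _ => Part.some ()).map fun _ => 0 :=
    hR.to_re.map (Computable.const 0).to₂
  obtain ⟨c, hc⟩ := Code.exists_code.1 (Partrec.nat_iff.1 h)
  exact ⟨c, fun x => by simp [hc, Part.assert]⟩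

open Filter in
/-- If `e` diverges at `s`, its last block is infinite, and there an infinite computable column
includes thick traces of its own index. -/
theorem IsTower.eventually_settled {F : Set ℕ} (hF : IsTower F) (j s : ℕ) :
    ∀ᶠ t in atTop, Settled j s t ((List.range t).map (charFun F)) := by
  classical
  by_cases hdom : (Code.eval (ofNat Code j.unpair.1) s).Dom
  · obtain ⟨k, hk⟩ := exists_isSome_evaln hdom
    obtain ⟨v, hv⟩ := Option.isSome_iff_exists.1 hk
    filter_upwards [eventually_ge_atTop k, eventually_gt_atTop v] with t htk htv
    exact Or.inl ⟨v, htv, Code.evaln_mono htk hv⟩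
  · obtain ⟨x₀, hx₀⟩ := exists_convLength_eq hdom
    obtain ⟨c, hc⟩ := (hF.computable j.unpair.2).exists_code
    set i := Nat.pair (encode c) s with hi
    have hinf : (column F j.unpair.2 ∩ Set.Ici (max x₀ s)).Infinite := by
      refine ((hF.infinite_column j.unpair.2).sdiff (Set.finite_Iio (max x₀ s))).mono ?_
      exact fun x hx => ⟨hx.1, Set.mem_Ici.2 (not_lt.1 hx.2)⟩
    obtain ⟨T, hT, hTc⟩ := hinf.exists_subset_card_eq (2 * i + 2)
    choose k hk using fun x : column F j.unpair.2 => exists_isSome_evaln ((hc x).2 x.2)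
    have hw : ∀ᶠ w in atTop, x₀ ≤ w ∧ ∀ x ∈ T, x < w ∧ (Code.evaln w c x).isSome := by
      refine (eventually_ge_atTop x₀).and ((eventually_all_finset T).2 fun x hx => ?_)
      filter_upwards [eventually_gt_atTop x, eventually_ge_atTop (k ⟨x, (hT hx).1⟩)] with w h1 h2
      exact ⟨h1, isSome_evaln_mono h2 (hk ⟨x, (hT hx).1⟩)⟩
    obtain ⟨w, hxw, hTw⟩ := hw.exists
    have hsub : T ⊆ (trace (ofNat Code j.unpair.1) i w).toFinset := by
      intro x hx
      have hge := (hT hx).2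
      simp only [Set.mem_Ici, max_le_iff] at hge
      rw [List.mem_toFinset, mem_trace]
      refine ⟨(hTw x hx).1, (hx₀ x hge.1).trans (hx₀ w hxw).symm, ?_, ?_⟩
      · simpa [hi] using hge.2
      · simpa [hi] using (hTw x hx).2
    have hthick : Thick (ofNat Code j.unpair.1) i w :=
      hTc.symm.le.trans ((Finset.card_le_card hsub).trans (List.toFinset_card_le _))
    have hlarge : ∀ᶠ t in atTop, ∀ x ∈ Finset.range w, cantorPair x j.unpair.2 < t :=
      (eventually_all_finset _).2 fun x _ => eventually_gt_atTop _
    filter_upwards [eventually_gt_atTop w, hlarge] with t htw ht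
    refine Or.inr ⟨w, htw, i, hthick.lt, by simp [hi], hthick, fun x hx => ?_⟩
    obtain ⟨h1, -, -, h4⟩ := mem_trace.1 hx
    refine getElem?_map_range_charFun.2 ⟨ht x (Finset.mem_range.2 h1), ?_⟩
    have h5 := dom_eval_of_isSome_evaln h4
    simp only [hi, Nat.unpair_pair, ofNat_encode] at h5
    exact (hc x).1 h5

theorem IsUltrafilterBase.eventually_le {F : Set ℕ} (hF : IsUltrafilterBase F) {h : ℕ → ℕ}
    (hh : ∀ s, ∀ j < s, Settled j s (h s) ((List.range (h s)).map (charFun F)))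
    {f : ℕ → ℕ} (hf : Computable f) : ∃ N, ∀ s ≥ N, f s ≤ h s := by
  obtain ⟨e, he⟩ := Code.exists_code.1 (Partrec.nat_iff.1 hf.partrec)
  have hev : ∀ k, Code.eval e k = Part.some (f k) := fun k => by rw [he]; rfl
  obtain ⟨R, hR, hsplit⟩ := exists_isComputableSet_splitting (e := e) fun k => by simp [hev k]
  obtain ⟨n, hn⟩ := hF.decides R hR
  -- Above `b` the column `n` is homogeneous for the splitting set, hence includes no thick trace.
  have hb : ∃ b, (∀ x ∈ column F n, b ≤ x → x ∉ R) ∨ ∀ x ∈ column F n, b ≤ x → x ∈ R := by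
    rcases hn with hn | hn <;> obtain ⟨b, hb⟩ := hn.bddAbove <;> refine ⟨b + 1, ?_⟩
    · refine Or.inl fun x hx hbx hxR => ?_
      have := hb (show x ∈ column F n \ Rᶜ from ⟨hx, fun h => h hxR⟩)
      omega
    · refine Or.inr fun x hx hbx => ?_
      by_contra hxR
      have := hb (show x ∈ column F n \ R from ⟨hx, hxR⟩)
      omega
  obtain ⟨b, hb⟩ := hb
  refine ⟨max b (Nat.pair (encode e) n + 1), fun s hs => ?_⟩
  have hset := hh s (Nat.pair (encode e) n) (le_of_max_le_right hs)
  simp only [Settled, Nat.unpair_pair, ofNat_encode] at hset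
  rcases hset with ⟨v, hv, hev'⟩ | ⟨w, -, i, -, his, ht, hsub⟩
  · have := Code.evaln_sound hev'
    rw [hev, Part.mem_some_iff] at this
    omega
  · have hcol : ∀ x ∈ trace e i w, x ∈ column F n ∧ b ≤ x := fun x hx =>
      ⟨(getElem?_map_range_charFun.1 (hsub x hx)).2,
        (le_of_max_le_left hs).trans (his ▸ (mem_trace.1 hx).2.2.1)⟩
    obtain ⟨⟨x, hx, hxR⟩, y, hy, hyR⟩ := hsplit i w ht
    rcases hb with hb | hb
    · exact absurd hxR (hb x (hcol x hx).1 (hcol x hx).2)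
    · exact absurd (hb y (hcol y hy).1 (hcol y hy).2) hyR

end MassProblem

open MassProblem in
theorem theorem3p6 :
    MassProblem.MedvedevReducible MassProblem.DomFcn MassProblem.UltrafilterBases := by
  have hQ : PrimrecPred fun p : ℕ × ℕ × List ℕ =>
      p.1 ≤ p.2.1 ∧ ∀ j < p.1, Settled j p.1 p.2.1 p.2.2 :=
    .and (Primrec.nat_le.comp Primrec.fst (Primrec.fst.comp Primrec.snd))
      (.forall_lt_param Primrec.fst primrecPred_settled)
  obtain ⟨Θ, hΘ, hsearch⟩ := IsTuringFunctional.exists_search hQ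
  refine ⟨Θ, hΘ, ?_⟩
  rintro _ ⟨F, hF, rfl⟩
  obtain ⟨h, hval, hh⟩ := hsearch (charFun F) fun s =>
    ((Filter.eventually_ge_atTop s).and ((Filter.eventually_all_finite (Set.finite_Iio s)).2
      fun j _ => hF.toIsTower.eventually_settled j s)).exists
  exact ⟨h, ⟨fun f hf => hF.eventually_le (fun s => (hh s).2) hf, fun s => (hh s).1⟩, hval⟩
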